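/- **Setting.** Let $A$ and $B$ be finite sets with $|A|=|B|=n$. Every $a\in A$ has a strict total order $\prec_a$ on $B$ and every $b\in B$ has a strict total order $\prec_b$ on $A$, where $x\prec_c y$ means that $c$ prefers $x$ to $y$. A matching is a bijection $M$ between $A$ and $B$. We write $M(a)$ and $M(b)$ for partners. $M$ is *stable* if there is no pair $(a,b)$ with $M(a)\ne b$, $b\prec_a M(a)$ and $a\prec_b M(b)$. A stable matching $M$ is *$B$-optimal* if no $b\in B$ prefers its partner in another stable matching to $M(b)$. The orders $\prec_a$ ($a\in A$) are known. The orders $\prec_b$ ($b\in B$) are unknown and can be accessed only through *comparison queries* $\mathrm{prefer}(b,a_1,a_2)$, which return the one of $a_1,a_2$ that $b$ prefers. **Optimum.** For a given instance, $\mathrm{OPT}$ is the minimum size of a set $Q$ of comparison queries whose true answers determine the $B$-optimal stable matching, i.e. such that one matching $M$ is stable and $B$-optimal for all families $(\prec'_b)_{b\in B}$ that give the same answers to all queries in $Q$ as $(\prec_b)_{b\in B}$. **Algorithm.** 1. Run deferred acceptance with $A$ proposing. While some $a\in A$ is unmatched, such an $a$ proposes to its most preferred $b$ that has not yet rejected it.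 If $b$ is unmatched, $a$ and $b$ are matched. Otherwise $\mathrm{prefer}(b,a,a')$ is queried, where $a'$ is the current partner of $b$. The agent $b$ is then matched to the preferred one of $a,a'$ and rejects the other. Let $M$ be the resulting matching, let $N$ be the set of all $a$ for which $M(a)$ is last in $\prec_a$, and for $a\notin N$ let $p(a)$ be the direct successor of $M(a)$ in $\prec_a$ and let $r(a)$ be undefined. 2. For each $a\in A\setminus N$ in turn, repeat the following until $r(a)$ is defined or $a\in N$: query $\mathrm{prefer}(p(a),a,M(p(a)))$. If the answer is $a$, set $r(a):=p(a)$. Otherwise, replace $p(a)$ by its direct successor in $\prec_a$, or, if $p(a)$ is last in $\prec_a$, put $a$ into $N$. 3. If there is a rotation, that is, a cyclic sequence of distinct agents $a_0,\dots,a_{m}$ in $A\setminus N$ with $r(a_k)=M(a_{k+1})$ for all $k$ (indices modulo $m+1$), choose one and apply it: rematch each $a_k$ to $r(a_k)$, and leave all other pairs of $M$ unchanged. Put every $a_k$ whose new partner is last in $\prec_{a_k}$ into $N$. For each other $a_k$ on the rotation let $p(a_k)$ be the direct successor of its new partner. For each $a\notin N$ that is not on the rotation set $p(a):=r(a)$.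 Make $r(a)$ undefined for all $a\notin N$, and go to Step 2. If there is no rotation, return $M$. **Theorem.** This algorithm is $\mathcal O(n)$-competitive for finding a $B$-optimal stable matching with comparison queries: there is an absolute constant $C$ such that for all $n$ and all instances with $|A|=|B|=n$, and for all choices that the algorithm leaves open (the proposing agent in Step 1, the order of the agents in Step 2, the rotation in Step 3), the algorithm terminates, returns a $B$-optimal stable matching, and makes at most $C\cdot n\cdot \mathrm{OPT}$ queries, where repeated queries are counted each time. -/

import Mathlib

universe u v

/-- A preference list over `X`: a strict total order, where `P.lt x y` means that `x` is
preferred to `y`. -/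
structure Pref (X : Type u) where
  lt : X → X → Prop
  isStrictTotalOrder : IsStrictTotalOrder X lt

namespace Pref

variable {X : Type u}

/-- `y` is the direct successor of `x` in the preference list. -/
def IsDirectSucc (P : Pref X) (x y : X) : Prop :=
  P.lt x y ∧ ∀ z, P.lt x z → ¬ P.lt z y

open Classical in
/-- The direct successor of `x` in the list; on a finite `X` the value is `none` exactly if `x` is
the last entry of the list. -/
noncomputable def next (P : Pref X) (x : X) : Option X :=
  if h : ∃ y, P.IsDirectSucc x y then some h.choose else none

/-- `x` is the most preferred element of the set `S`. -/
def IsFavourite (P : Pref X) (S : Set X) (x : X) : Prop :=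
  x ∈ S ∧ ∀ y ∈ S, ¬ P.lt y x

end Pref

namespace StableMatching

variable {A : Type u} {B : Type v}

/-! ### Stable and `B`-optimal matchings -/

/-- `(a, b)` is a blocking pair of the matching `M`. -/
def IsBlockingPair (PA : A → Pref B) (PB : B → Pref A) (M : A ≃ B) (a : A) (b : B) : Prop :=
  M a ≠ b ∧ (PA a).lt b (M a) ∧ (PB b).lt a (M.symm b)

def IsStable (PA : A → Pref B) (PB : B → Pref A) (M : A ≃ B) : Prop :=
  ∀ a b, ¬ IsBlockingPair PA PB M a b

/-- `M` is stable, and no agent in `B` prefers another stable matching to `M`. -/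
def IsBOptimal (PA : A → Pref B) (PB : B → Pref A) (M : A ≃ B) : Prop :=
  IsStable PA PB M ∧
    ∀ M' : A ≃ B, IsStable PA PB M' → ∀ b, ¬ (PB b).lt (M'.symm b) (M.symm b)

/-! ### Comparison queries and the offline optimum -/

open Classical in
/-- The answer to the comparison query `prefer(b, x, y)`: the agent among `x` and `y` that `b`
prefers. -/
noncomputable def prefer (PB : B → Pref A) (b : B) (x y : A) : A :=
  if (PB b).lt x y then x else y

/-- The set `Q` of comparison queries (`(b, x, y)` stands for `prefer(b, x, y)`) suffices, on the
instance with true preferences `PB`, to identify the `B`-optimal stable matching: some matching is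
`B`-optimal for all preferences of the `B`-side that give the same answers to the queries in `Q`. -/
def Certifies (PA : A → Pref B) (PB : B → Pref A) (Q : Finset (B × A × A)) : Prop :=
  ∃ M : A ≃ B, ∀ PB' : B → Pref A,
    (∀ q ∈ Q, prefer PB' q.1 q.2.1 q.2.2 = prefer PB q.1 q.2.1 q.2.2) → IsBOptimal PA PB' M

/-- The minimum number of comparison queries after which the `B`-optimal stable matching of the
given instance is known. -/
noncomputable def opt (PA : A → Pref B) (PB : B → Pref A) : ℕ :=
  sInf {k | ∃ Q : Finset (B × A × A), Certifies PA PB Q ∧ Q.card = k}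

/-! ### Algorithms that make comparison queries -/

/-- What happens in one step of an algorithm: either an internal computation, or the query
`prefer(b, x, y)` together with the answer received. -/
inductive Event (A : Type u) (B : Type v) : Type (max u v)
  | internal : Event A B
  | query (b : B) (x y : A) (answer : A) : Event A B

/-- Queries are answered according to the true preferences `PB`. -/
def Event.Truthful (PB : B → Pref A) : Event A B → Prop
  | .internal => True
  | .query b x y answer => answer = prefer PB b x y

/-- The number of queries made in a step. -/
def Event.cost : Event A B → ℕ
  | .internal => 0
  | .query _ _ _ _ => 1

/-- An algorithm making comparison queries, as a transition system. The preferences of the `B`-side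
do not occur in it: they influence the run only through the answers to the queries. Several
transitions may be possible from a state, as the algorithm may leave choices open. -/
structure QueryAlgorithm (A : Type u) (B : Type v) where
  State : Type (max u v)
  start : State
  Step : State → Event A B → State → Prop
  output : State → Option (A ≃ B)

namespace QueryAlgorithm

/-- A step that is possible if the preferences of the `B`-side are `PB`. -/
def TrueStep (alg : QueryAlgorithm A B) (PB : B → Pref A) (s : alg.State) (e : Event A B)
    (s' : alg.State) : Prop :=
  alg.Step s e s' ∧ e.Truthful PB

/-- `alg.Reaches PB k s`: when the preferences of the `B`-side are `PB`, some execution from the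
start leads to the state `s` and makes exactly `k` queries (repeated queries are all counted). -/
inductive Reaches (alg : QueryAlgorithm A B) (PB : B → Pref A) : ℕ → alg.State → Prop
  | start : Reaches alg PB 0 alg.start
  | step {k : ℕ} {s s' : alg.State} {e : Event A B} :
      Reaches alg PB k s → alg.TrueStep PB s e s' → Reaches alg PB (k + e.cost) s'

/-- When the preferences of the `B`-side are `PB`, all executions terminate. -/
def Terminates (alg : QueryAlgorithm A B) (PB : B → Pref A) : Prop :=
  ¬ ∃ f : ℕ → alg.State, f 0 = alg.start ∧ ∀ i, ∃ e, alg.TrueStep PB (f i) e (f (i + 1))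

/-- When the preferences of the two sides are `PA` and `PB`, every execution terminates, and ends by
outputting a `B`-optimal stable matching. -/
def FindsBOptimal (alg : QueryAlgorithm A B) (PA : A → Pref B) (PB : B → Pref A) : Prop :=
  alg.Terminates PB ∧
    ∀ k s, alg.Reaches PB k s → (¬ ∃ e s', alg.TrueStep PB s e s') →
      ∃ M, alg.output s = some M ∧ IsBOptimal PA PB M

/-- No execution makes more than `q` queries when the preferences of the `B`-side are `PB`. -/
def QueriesAtMost (alg : QueryAlgorithm A B) (PB : B → Pref A) (q : ℕ) : Prop :=
  ∀ k s, alg.Reaches PB k s → k ≤ q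

end QueryAlgorithm

/-! ### The algorithm: deferred acceptance followed by applying rotations -/

/-- The variables in the second part of the algorithm: the current matching `M`, the set `N` of
agents known to have no `r`-edge, the next agent `p a` to be asked for `a`, the known `r`-edge
`r a` of `a` (`none` if still unknown), the agents `todo` that the loop over `A \ N` has not yet
considered, and the agent `cur` that it is currently considering. -/
structure SearchState (A : Type u) (B : Type v) where
  M : A ≃ B
  N : Set A
  p : A → Option B
  r : A → Option B
  todo : Set A
  cur : Option A

/-- The states of the algorithm. During deferred acceptance, `held b` is the agent `b` is currently
matched to, and `declined a` is the set of agents by whom `a` has been rejected. -/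
inductive AlgState (A : Type u) (B : Type v) : Type (max u v)
  | proposing (held : B → Option A) (declined : A → Set B) : AlgState A B
  | searching (s : SearchState A B) : AlgState A B
  | halted (M : A ≃ B) : AlgState A B

namespace SearchState

/-- The start of the search, with the matching `M` obtained by deferred acceptance. -/
noncomputable def init (PA : A → Pref B) (M : A ≃ B) : SearchState A B where
  M := M
  N := {a | (PA a).next (M a) = none}
  p := fun a => (PA a).next (M a)
  r := fun _ => none
  todo := {a | (PA a).next (M a) = none}ᶜ
  cur := none

/-- The pairs `(R 0, M (R 0)), …, (R m, M (R m))` form a rotation with respect to the `r`-edges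
found by the algorithm, that is, the `r`-edge of each `R k` leads to the partner of `R (k + 1)`;
the index `k + 1` is taken modulo `m + 1`. -/
def IsRotation (s : SearchState A B) {m : ℕ} (R : Fin (m + 1) → A) : Prop :=
  Function.Injective R ∧ ∀ k, R k ∉ s.N ∧ s.r (R k) = some (s.M (R (k + 1)))

/-- `M'` results from the current matching by applying the rotation `R`. -/
def IsApplied (s : SearchState A B) {m : ℕ} (R : Fin (m + 1) → A) (M' : A ≃ B) : Prop :=
  (∀ k, s.r (R k) = some (M' (R k))) ∧ ∀ a, a ∉ Set.range R → M' a = s.M a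

/-- The set `N` after a rotation with set of agents `S` has been applied, giving `M'`. -/
def newN (PA : A → Pref B) (s : SearchState A B) (S : Set A) (M' : A ≃ B) : Set A :=
  s.N ∪ {a ∈ S | (PA a).next (M' a) = none}

open Classical in
/-- The update of the variables after a rotation with set of agents `S` has been applied, giving
`M'`: agents on the rotation restart right after their new partner, the others restart at their
previous `r`-edge. -/
noncomputable def afterRotation (PA : A → Pref B) (s : SearchState A B) (S : Set A) (M' : A ≃ B) :
    SearchState A B where
  M := M'
  N := s.newN PA S M'
  p := fun a =>
    if a ∈ s.newN PA S M' then s.p a else if a ∈ S then (PA a).next (M' a) else s.r a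
  r := fun a => if a ∈ s.newN PA S M' then s.r a else none
  todo := (s.newN PA S M')ᶜ
  cur := none

end SearchState

open Classical in
/-- The steps of the algorithm. -/
inductive AlgStep (PA : A → Pref B) : AlgState A B → Event A B → AlgState A B → Prop
  /-- An unmatched `a` proposes to its favourite `b` among those who have not rejected it, and `b`
  is unmatched. -/
  | proposeFree {held : B → Option A} {declined : A → Set B} {a : A} {b : B}
      (hfree : ∀ b', held b' ≠ some a) (hfav : (PA a).IsFavourite (declined a)ᶜ b)
      (hheld : held b = none) :
      AlgStep PA (.proposing held declined) .internal
        (.proposing (Function.update held b (some a)) declined)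
  /-- An unmatched `a` proposes to `b`, who prefers `a` to her current partner `a'`. -/
  | proposeAccepted {held : B → Option A} {declined : A → Set B} {a a' : A} {b : B}
      (hfree : ∀ b', held b' ≠ some a) (hfav : (PA a).IsFavourite (declined a)ᶜ b)
      (hheld : held b = some a') :
      AlgStep PA (.proposing held declined) (.query b a a' a)
        (.proposing (Function.update held b (some a))
          (Function.update declined a' (insert b (declined a'))))
  /-- An unmatched `a` proposes to `b`, who prefers her current partner `a'` to `a`. -/
  | proposeRejected {held : B → Option A} {declined : A → Set B} {a a' : A} {b : B}
      (hfree : ∀ b', held b' ≠ some a) (hfav : (PA a).IsFavourite (declined a)ᶜ b)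
      (hheld : held b = some a') :
      AlgStep PA (.proposing held declined) (.query b a a' a')
        (.proposing held (Function.update declined a (insert b (declined a))))
  /-- All agents are matched: the search for rotations starts. -/
  | startSearch {held : B → Option A} {declined : A → Set B} {M : A ≃ B}
      (hM : ∀ a, held (M a) = some a) :
      AlgStep PA (.proposing held declined) .internal (.searching (SearchState.init PA M))
  /-- The loop over `A \ N` turns to its next agent `a`. -/
  | consider {s : SearchState A B} {a : A} (hcur : s.cur = none) (ha : a ∈ s.todo) :
      AlgStep PA (.searching s) .internal
        (.searching { s with todo := s.todo \ {a}, cur := some a })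
  /-- `b = p a` prefers her current partner to `a`, and `b'` is next on the list of `a`. -/
  | searchOn {s : SearchState A B} {a : A} {b b' : B} (hcur : s.cur = some a)
      (hp : s.p a = some b) (hnext : (PA a).next b = some b') :
      AlgStep PA (.searching s) (.query b a (s.M.symm b) (s.M.symm b))
        (.searching { s with p := Function.update s.p a (some b') })
  /-- `b = p a` prefers her current partner to `a`, and `b` is last on the list of `a`. -/
  | searchExhausted {s : SearchState A B} {a : A} {b : B} (hcur : s.cur = some a)
      (hp : s.p a = some b) (hlast : (PA a).next b = none) :
      AlgStep PA (.searching s) (.query b a (s.M.symm b) (s.M.symm b))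
        (.searching { s with N := insert a s.N, cur := none })
  /-- `b = p a` prefers `a` to her current partner: an `r`-edge has been found. -/
  | searchFound {s : SearchState A B} {a : A} {b : B} (hcur : s.cur = some a)
      (hp : s.p a = some b) :
      AlgStep PA (.searching s) (.query b a (s.M.symm b) a)
        (.searching { s with r := Function.update s.r a (some b), cur := none })
  /-- The loop is over and the `r`-edges contain a rotation `R`: it is applied, and the loop starts
  again. -/
  | rotate {s : SearchState A B} {m : ℕ} {R : Fin (m + 1) → A} {M' : A ≃ B} (hcur : s.cur = none)
      (htodo : s.todo = ∅) (hR : s.IsRotation R) (hM' : s.IsApplied R M') :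
      AlgStep PA (.searching s) .internal (.searching (s.afterRotation PA (Set.range R) M'))
  /-- The loop is over and the `r`-edges contain no rotation: the algorithm returns `M`. -/
  | finish {s : SearchState A B} (hcur : s.cur = none) (htodo : s.todo = ∅)
      (hno : ¬ ∃ (m : ℕ) (R : Fin (m + 1) → A), s.IsRotation R) :
      AlgStep PA (.searching s) .internal (.halted s.M)

/-- The output of the algorithm: a matching in halted states, nothing otherwise. -/
def algOutput : AlgState A B → Option (A ≃ B)
  | .halted M => some M
  | _ => none

/-- The algorithm for finding the `B`-optimal stable matching with comparison queries, run on the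
known preferences `PA` of the `A`-side. -/
def bOptimalAlgorithm (PA : A → Pref B) : QueryAlgorithm A B where
  State := AlgState A B
  start := .proposing (fun _ => none) (fun _ => ∅)
  Step := AlgStep PA
  output := algOutput

end StableMatching

/-! Write `n` for the number of agents on each side. Two lower bounds on OPT are played against one
potential.

Lower bounds. Let `Q` certify `M`. If `a` prefers `b` to `M a`, then `a` must lose some query of `Q`
at `b`: otherwise `a` could be on top of the list of `b` and block `M`. A query has one loser, so
the ranks of the partners in `M` sum to at most the size of `Q` (`rankSum_le_card`). As
`B`-optimality gives each `a` its worst stable partner, this bounds the rank sum of every stable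
matching. Moreover, `n ≤ 3 * OPT + 1`, because `Q` cannot leave two pairs of `M` untouched
(`not_untouched`).

Upper bound. Every matching in the search is stable, and a rotation makes the rank sum grow, so
there are at most OPT rotations. Between rotations each `a` finds at most one `r`-edge, while
unsuccessful queries advance along lists on which the search never moves back. Together with
deferred acceptance this gives `O(n ^ 2 + n * OPT)` queries, which is `O(n * OPT)` for `n ≥ 2`. The
`potential` does this bookkeeping and also proves termination.

Correctness. Rotations only improve the partners of `B`, so rejections stay valid (`SearchInv`). If
some stable `M'` were better for some `b`, following `r`-edges among the agents of `A` that prefer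
the current matching to `M'` would close up to a rotation (`SearchInv.isBOptimal`). -/

/-! ### Preference lists -/

namespace Pref

variable {X : Type u}

theorem irrefl (P : Pref X) (x : X) : ¬ P.lt x x :=
  P.isStrictTotalOrder.irrefl x

theorem trans (P : Pref X) {x y z : X} (hxy : P.lt x y) (hyz : P.lt y z) : P.lt x z :=
  P.isStrictTotalOrder.trans x y z hxy hyz

theorem asymm (P : Pref X) {x y : X} (hxy : P.lt x y) : ¬ P.lt y x :=
  fun hyx => P.irrefl x (P.trans hxy hyx)

theorem ne_of_lt (P : Pref X) {x y : X} (hxy : P.lt x y) : x ≠ y := by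
  rintro rfl
  exact P.irrefl x hxy

theorem lt_of_not_lt (P : Pref X) {x y : X} (hne : x ≠ y) (h : ¬ P.lt x y) : P.lt y x := by
  by_contra h'
  exact hne (P.isStrictTotalOrder.trichotomous x y h h')

theorem eq_or_lt_of_not_lt (P : Pref X) {x y : X} (h : ¬ P.lt x y) : y = x ∨ P.lt y x := by
  by_cases hne : x = y
  · exact .inl hne.symm
  · exact .inr (P.lt_of_not_lt hne h)

theorem ext {P P' : Pref X} (h : ∀ x y, P.lt x y ↔ P'.lt x y) : P = P' := by
  cases P
  cases P'
  simp only [mk.injEq]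
  ext x y
  exact h x y

theorem exists_isFavourite [Finite X] (P : Pref X) {S : Set X} (hS : S.Nonempty) :
    ∃ x, P.IsFavourite S x := by
  have := P.isStrictTotalOrder
  obtain ⟨x, hx, hmin⟩ := (Finite.wellFounded_of_trans_of_irrefl P.lt).has_min S hS
  exact ⟨x, hx, hmin⟩

theorem isDirectSucc_of_next_eq_some {P : Pref X} {x y : X} (h : P.next x = some y) :
    P.IsDirectSucc x y := by
  unfold next at h
  split_ifs at h with h'
  cases h
  exact h'.choose_spec

/-- If anything came after `x`, the favourite among all later elements would be a direct successor.
-/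
theorem not_lt_of_next_eq_none [Finite X] {P : Pref X} {x : X} (h : P.next x = none) (y : X) :
    ¬ P.lt x y := by
  intro hxy
  unfold next at h
  split_ifs at h with h'
  obtain ⟨z, hz, hmin⟩ := P.exists_isFavourite (S := {y | P.lt x y}) ⟨y, hxy⟩
  exact h' ⟨z, hz, hmin⟩

/-- The number of elements preferred to `x`. -/
noncomputable def rank (P : Pref X) (x : X) : ℕ :=
  {y | P.lt y x}.ncard

theorem rank_lt_rank [Finite X] (P : Pref X) {x y : X} (h : P.lt x y) : P.rank x < P.rank y := by
  refine Set.ncard_lt_ncard ?_ (Set.toFinite _)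
  refine ⟨fun z hz => P.trans hz h, fun hsub => P.irrefl x (hsub h)⟩

theorem rank_lt_card [Fintype X] (P : Pref X) (x : X) : P.rank x < Fintype.card X := by
  rw [← Nat.card_eq_fintype_card, ← Set.ncard_univ]
  refine Set.ncard_lt_ncard ?_ (Set.toFinite _)
  exact ⟨Set.subset_univ _, fun hsub => P.irrefl x (hsub (Set.mem_univ x))⟩

/-- The list ordered by the level `f` first, and by `P` within each level. -/
def relevel (P : Pref X) (f : X → ℕ) : Pref X where
  lt x y := f x < f y ∨ (f x = f y ∧ P.lt x y)
  isStrictTotalOrder :=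
    { trichotomous := fun x y h h' => by
        push Not at h h'
        have hf : f x = f y := le_antisymm h'.1 h.1
        by_contra hne
        exact h'.2 hf.symm (P.lt_of_not_lt hne (h.2 hf))
      irrefl := fun x h => by
        rcases h with h | h
        · exact lt_irrefl _ h
        · exact P.irrefl x h.2
      trans := fun x y z h h' => by
        rcases h with h | ⟨h, hP⟩ <;> rcases h' with h' | ⟨h', hP'⟩
        · exact .inl (h.trans h')
        · exact .inl (h'.symm ▸ h)
        · exact .inl (h.symm ▸ h')
        · exact .inr ⟨h.trans h', P.trans hP hP'⟩ }

theorem relevel_lt_iff (P : Pref X) (f : X → ℕ) (x y : X) :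
    (P.relevel f).lt x y ↔ f x < f y ∨ (f x = f y ∧ P.lt x y) :=
  Iff.rfl

open Classical in
/-- The list obtained by moving `a` to the top. -/
noncomputable def moveToTop (P : Pref X) (a : X) : Pref X :=
  P.relevel fun x => if x = a then 0 else 1

theorem moveToTop_lt_of_ne (P : Pref X) {a x : X} (h : x ≠ a) : (P.moveToTop a).lt a x := by
  simp [moveToTop, relevel_lt_iff, h]

theorem not_moveToTop_lt (P : Pref X) (a x : X) : ¬ (P.moveToTop a).lt x a := by
  by_cases h : x = a
  · subst h
    exact (P.moveToTop x).irrefl x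
  · exact (P.moveToTop a).asymm (P.moveToTop_lt_of_ne h)

theorem moveToTop_lt_iff (P : Pref X) {a x y : X} (hx : x ≠ a) (hy : y ≠ a) :
    (P.moveToTop a).lt x y ↔ P.lt x y := by
  simp [moveToTop, relevel_lt_iff, hx, hy]

open Classical in
/-- The list obtained by moving the elements of `S` to the bottom. -/
noncomputable def moveToBottom (P : Pref X) (S : Set X) : Pref X :=
  P.relevel fun x => if x ∈ S then 1 else 0

theorem not_moveToBottom_lt (P : Pref X) {S : Set X} {x y : X} (hx : x ∈ S) (hy : y ∉ S) :
    ¬ (P.moveToBottom S).lt x y := by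
  simp [moveToBottom, relevel_lt_iff, hx, hy]

theorem moveToBottom_lt_iff (P : Pref X) {S : Set X} {x y : X} (hx : x ∉ S) (hy : y ∉ S) :
    (P.moveToBottom S).lt x y ↔ P.lt x y := by
  simp [moveToBottom, relevel_lt_iff, hx, hy]

end Pref

namespace StableMatching

variable {A : Type u} {B : Type v} {PA : A → Pref B} {PB : B → Pref A}

/-! ### Comparison queries -/

theorem prefer_eq_left_iff {b : B} {x y : A} (hne : x ≠ y) :
    prefer PB b x y = x ↔ (PB b).lt x y := by
  unfold prefer
  split_ifs with h
  · simp [h]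
  · simp [h, hne.symm]

theorem prefer_eq_right_iff {b : B} {x y : A} (hne : x ≠ y) :
    prefer PB b x y = y ↔ (PB b).lt y x := by
  unfold prefer
  split_ifs with h
  · simp [hne, (PB b).asymm h]
  · simpa using (PB b).lt_of_not_lt hne h

theorem prefer_eq_or (PB : B → Pref A) (b : B) (x y : A) :
    prefer PB b x y = x ∨ prefer PB b x y = y := by
  unfold prefer
  split_ifs <;> simp

theorem prefer_congr {PB' : B → Pref A} {b : B} {x y : A}
    (h : (PB' b).lt x y ↔ (PB b).lt x y) : prefer PB' b x y = prefer PB b x y := by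
  unfold prefer
  by_cases h' : (PB b).lt x y
  · rw [if_pos h', if_pos (h.2 h')]
  · rw [if_neg h', if_neg (mt h.1 h')]

theorem prefer_self (b : B) (x : A) : prefer PB b x x = x := by
  simp [prefer]

open Classical in
/-- The agent that loses a comparison. -/
noncomputable def loser (PB : B → Pref A) (q : B × A × A) : A :=
  if prefer PB q.1 q.2.1 q.2.2 = q.2.1 then q.2.2 else q.2.1

/-! ### Consequences of stability -/

theorem IsStable.lt_of_lt {M : A ≃ B} (hM : IsStable PA PB M) {a : A} {b : B}
    (h : (PA a).lt b (M a)) : (PB b).lt (M.symm b) a := by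
  have hne : M a ≠ b := ((PA a).ne_of_lt h).symm
  refine (PB b).lt_of_not_lt ?_ fun h' => hM a b ⟨hne, h, h'⟩
  rintro rfl
  simp at hne

theorem isStable_of_forall_lt {M : A ≃ B}
    (h : ∀ a b, (PA a).lt b (M a) → ¬ (PB b).lt a (M.symm b)) : IsStable PA PB M :=
  fun a b hab => h a b hab.2.1 hab.2.2

/-- The interests of the two sides are opposed: if `a` lost by moving from `M` to `M'`, stability of
`M'` would make `M a` gain. -/
theorem IsBOptimal.not_lt {M M' : A ≃ B} (hM : IsBOptimal PA PB M) (hM' : IsStable PA PB M')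
    (a : A) : ¬ (PA a).lt (M a) (M' a) := by
  intro h
  have := hM.2 M' hM' (M a)
  exact this (by simpa using hM'.lt_of_lt h)

/-- The sum of the ranks of the partners of the agents in `A`. -/
noncomputable def rankSum [Fintype A] (PA : A → Pref B) (M : A ≃ B) : ℕ :=
  ∑ a, (PA a).rank (M a)

theorem IsBOptimal.rankSum_le [Fintype A] [Finite B] {M M' : A ≃ B}
    (hM : IsBOptimal PA PB M) (hM' : IsStable PA PB M') : rankSum PA M' ≤ rankSum PA M := by
  refine Finset.sum_le_sum fun a _ => ?_
  rcases (PA a).eq_or_lt_of_not_lt (hM.not_lt hM' a) with h | h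
  · rw [h]
  · exact ((PA a).rank_lt_rank h).le

/-! ### Lower bounds on the size of a certificate -/

/-- Adversary argument: if `a` loses no query at `b`, moving `a` to the top of the list of `b`
changes no answer, but makes `(a, b)` block `M`. -/
theorem exists_query_of_lt {Q : Finset (B × A × A)} {M : A ≃ B}
    (hM : ∀ PB' : B → Pref A,
      (∀ q ∈ Q, prefer PB' q.1 q.2.1 q.2.2 = prefer PB q.1 q.2.1 q.2.2) → IsBOptimal PA PB' M)
    {a : A} {b : B} (hab : (PA a).lt b (M a)) : ∃ q ∈ Q, q.1 = b ∧ loser PB q = a := by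
  classical
  by_contra! hno
  have hst := (hM (Function.update PB b ((PB b).moveToTop a)) ?_).1
  · have := hst.lt_of_lt hab
    simp only [Function.update_self] at this
    exact (PB b).not_moveToTop_lt _ _ this
  rintro ⟨b', x, y⟩ hq
  by_cases hb : b' = b
  · subst hb
    have hl := hno _ hq rfl
    unfold loser at hl
    dsimp only at hl ⊢
    by_cases hxy : x = y
    · subst hxy
      rw [prefer_self, prefer_self]
    by_cases hx : x = a
    · subst hx
      have h1 : prefer PB b' x y = x := by
        by_contra h
        simp [h] at hl
      rw [h1, prefer_eq_left_iff hxy, Function.update_self]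
      exact (PB b').moveToTop_lt_of_ne (Ne.symm hxy)
    by_cases hy : y = a
    · subst hy
      have h1 : prefer PB b' x y = y := by
        refine (prefer_eq_or PB b' x y).resolve_left fun h => ?_
        simp [h] at hl
      rw [h1, prefer_eq_right_iff hxy, Function.update_self]
      exact (PB b').moveToTop_lt_of_ne hxy
    refine prefer_congr ?_
    rw [Function.update_self]
    exact (PB b').moveToTop_lt_iff hx hy
  · refine prefer_congr ?_
    rw [Function.update_of_ne hb]

/-- The rank sum counts the pairs `(a, b)` to which `exists_query_of_lt` applies, and a query serves
only the pair of its loser and the agent asked. -/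
theorem rankSum_le_card [Fintype A] [Fintype B] {Q : Finset (B × A × A)} {M : A ≃ B}
    (hM : ∀ PB' : B → Pref A,
      (∀ q ∈ Q, prefer PB' q.1 q.2.1 q.2.2 = prefer PB q.1 q.2.1 q.2.2) → IsBOptimal PA PB' M) :
    rankSum PA M ≤ Q.card := by
  classical
  have hcard : rankSum PA M =
      (Finset.univ.sigma fun a => Finset.univ.filter fun b => (PA a).lt b (M a)).card := by
    rw [Finset.card_sigma]
    refine Finset.sum_congr rfl fun a _ => ?_
    rw [Pref.rank, Set.ncard_eq_toFinset_card', Set.toFinset_ofPred]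
  rw [hcard]
  refine le_trans (Finset.card_le_card ?_)
    (Finset.card_image_le (s := Q) (f := fun q => (⟨loser PB q, q.1⟩ : Σ _ : A, B)))
  rintro ⟨a, b⟩ hab
  simp only [Finset.mem_sigma, Finset.mem_univ, Finset.mem_filter, true_and] at hab
  obtain ⟨q, hq, rfl, rfl⟩ := exists_query_of_lt hM hab
  exact Finset.mem_image_of_mem _ hq

/-- Two pairs of a certified matching cannot both be left untouched by the queries. -/
theorem not_untouched {Q : Finset (B × A × A)} {M : A ≃ B}
    (hM : ∀ PB' : B → Pref A,
      (∀ q ∈ Q, prefer PB' q.1 q.2.1 q.2.2 = prefer PB q.1 q.2.1 q.2.2) → IsBOptimal PA PB' M)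
    {a₁ a₂ : A} (hne : a₁ ≠ a₂)
    (h₁ : ∀ q ∈ Q, M.symm q.1 ≠ a₁ ∧ q.2.1 ≠ a₁ ∧ q.2.2 ≠ a₁)
    (h₂ : ∀ q ∈ Q, M.symm q.1 ≠ a₂ ∧ q.2.1 ≠ a₂ ∧ q.2.2 ≠ a₂) : False := by
  classical
  -- These lists make the swap of `a₁` and `a₂` stable: the two agents of `B` involved get their
  -- favourites, nobody else in `B` wants `a₁` or `a₂`, and a blocking pair away from the swap would
  -- already block `M`. No query sees the change.
  let PB' : B → Pref A := fun b =>
    if b = M a₁ then (PB b).moveToTop a₂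
    else if b = M a₂ then (PB b).moveToTop a₁
    else (PB b).moveToBottom {a₁, a₂}
  have hb₁ : PB' (M a₁) = (PB (M a₁)).moveToTop a₂ := by simp [PB']
  have hb₂ : PB' (M a₂) = (PB (M a₂)).moveToTop a₁ := by simp [PB', hne.symm]
  have hb : ∀ b, b ≠ M a₁ → b ≠ M a₂ → PB' b = (PB b).moveToBottom {a₁, a₂} := by
    intro b h h'
    simp [PB', h, h']
  have hopt : IsBOptimal PA PB' M := by
    refine hM PB' fun q hq => prefer_congr ?_
    obtain ⟨h11, h12, h13⟩ := h₁ q hq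
    obtain ⟨h21, h22, h23⟩ := h₂ q hq
    rw [hb q.1 (fun h => h11 (by simp [h])) (fun h => h21 (by simp [h]))]
    exact (PB q.1).moveToBottom_lt_iff (by simp [h12, h22]) (by simp [h13, h23])
  let M' : A ≃ B := (Equiv.swap a₁ a₂).trans M
  have hM'symm : ∀ b, M'.symm b = Equiv.swap a₁ a₂ (M.symm b) := fun b => by simp [M']
  have hM' : IsStable PA PB' M' := by
    refine isStable_of_forall_lt fun a b hab hba => ?_
    rw [hM'symm] at hba
    by_cases e₁ : b = M a₁
    · subst e₁
      rw [hb₁, Equiv.symm_apply_apply, Equiv.swap_apply_left] at hba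
      exact Pref.not_moveToTop_lt _ _ _ hba
    by_cases e₂ : b = M a₂
    · subst e₂
      rw [hb₂, Equiv.symm_apply_apply, Equiv.swap_apply_right] at hba
      exact Pref.not_moveToTop_lt _ _ _ hba
    have n₁ : M.symm b ≠ a₁ := fun h => e₁ (by simp [← h])
    have n₂ : M.symm b ≠ a₂ := fun h => e₂ (by simp [← h])
    rw [Equiv.swap_apply_of_ne_of_ne n₁ n₂] at hba
    by_cases ha : a ∈ ({a₁, a₂} : Set A)
    · rw [hb b e₁ e₂] at hba
      exact Pref.not_moveToBottom_lt _ ha (by simp [n₁, n₂]) hba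
    · simp only [Set.mem_insert_iff, Set.mem_singleton_iff, not_or] at ha
      have : M' a = M a := by simp [M', Equiv.swap_apply_of_ne_of_ne ha.1 ha.2]
      rw [this] at hab
      exact (PB' b).asymm (hopt.1.lt_of_lt hab) hba
  refine hopt.2 M' hM' (M a₁) ?_
  rw [hM'symm, hb₁, Equiv.symm_apply_apply, Equiv.swap_apply_left]
  exact Pref.moveToTop_lt_of_ne _ hne

/-- A query touches at most three pairs of `M`: that of the agent asked and those of the two agents
compared. By `not_untouched`, at most one pair remains. -/
theorem card_le_of_certifies [Fintype A] {Q : Finset (B × A × A)} {M : A ≃ B}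
    (hM : ∀ PB' : B → Pref A,
      (∀ q ∈ Q, prefer PB' q.1 q.2.1 q.2.2 = prefer PB q.1 q.2.1 q.2.2) → IsBOptimal PA PB' M) :
    Fintype.card A ≤ 3 * Q.card + 1 := by
  classical
  by_contra! hlt
  let T : Finset A :=
    Q.image (fun q => M.symm q.1) ∪ Q.image (fun q => q.2.1) ∪ Q.image (fun q => q.2.2)
  have hT : T.card ≤ 3 * Q.card := by
    have h₁ := Finset.card_image_le (s := Q) (f := fun q => M.symm q.1)
    have h₂ := Finset.card_image_le (s := Q) (f := fun q => q.2.1)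
    have h₃ := Finset.card_image_le (s := Q) (f := fun q => q.2.2)
    have h₄ := Finset.card_union_le
      (Q.image (fun q => M.symm q.1) ∪ Q.image (fun q => q.2.1)) (Q.image (fun q => q.2.2))
    have h₅ := Finset.card_union_le (Q.image (fun q => M.symm q.1)) (Q.image (fun q => q.2.1))
    simp only [T]
    omega
  have hTc : 1 < Tᶜ.card := by
    rw [Finset.card_compl]
    omega
  obtain ⟨a₁, h₁, a₂, h₂, hne⟩ := Finset.one_lt_card.1 hTc
  simp only [T, Finset.mem_compl, Finset.mem_union, Finset.mem_image, not_or, not_exists,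
    not_and] at h₁ h₂
  exact not_untouched hM hne (fun q hq => ⟨h₁.1.1 q hq, h₁.1.2 q hq, h₁.2 q hq⟩)
    (fun q hq => ⟨h₂.1.1 q hq, h₂.1.2 q hq, h₂.2 q hq⟩)

/-- Ensures that the infimum defining `opt` is over a nonempty set and hence attained. -/
theorem certifies_univ [Fintype A] [Fintype B] {M : A ≃ B} (hM : IsBOptimal PA PB M) :
    Certifies PA PB Finset.univ := by
  refine ⟨M, fun PB' h => ?_⟩
  suffices hPB : PB' = PB by rwa [hPB]
  funext b
  refine Pref.ext fun x y => ?_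
  by_cases hxy : x = y
  · subst hxy
    exact iff_of_false (Pref.irrefl _ _) (Pref.irrefl _ _)
  · rw [← prefer_eq_left_iff hxy, ← prefer_eq_left_iff hxy, h (b, x, y) (Finset.mem_univ _)]

/-- The two lower bounds on the offline optimum: the agents in `A` other than one, up to a factor
`3`, and the ranks in the `B`-optimal, hence in any, stable matching. -/
theorem opt_bounds [Fintype A] [Fintype B] {M : A ≃ B} (hM : IsBOptimal PA PB M) :
    Fintype.card A ≤ 3 * opt PA PB + 1 ∧
      ∀ M' : A ≃ B, IsStable PA PB M' → rankSum PA M' ≤ opt PA PB := by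
  obtain ⟨Q, ⟨M₀, hM₀⟩, hcard⟩ :=
    Nat.sInf_mem (s := {k | ∃ Q : Finset (B × A × A), Certifies PA PB Q ∧ Q.card = k})
      ⟨_, Finset.univ, certifies_univ hM, rfl⟩
  change Q.card = opt PA PB at hcard
  rw [← hcard]
  -- The true preferences agree with their own answers, so the certified `M₀` is `B`-optimal for
  -- `PB`.
  exact ⟨card_le_of_certifies hM₀, fun M' hM' =>
    ((hM₀ PB fun _ _ => rfl).rankSum_le hM').trans (rankSum_le_card hM₀)⟩

/-! ### Deferred acceptance -/

/-- The invariant of deferred acceptance. -/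
structure ProposingInv (PA : A → Pref B) (PB : B → Pref A) (held : B → Option A)
    (declined : A → Set B) : Prop where
  injective : ∀ a b b', held b = some a → held b' = some a → b = b'
  isFavourite : ∀ a b, held b = some a → (PA a).IsFavourite (declined a)ᶜ b
  exists_lt : ∀ a, ∀ b ∈ declined a, ∃ a', held b = some a' ∧ (PB b).lt a' a

namespace ProposingInv

variable {held : B → Option A} {declined : A → Set B}

theorem start (PA : A → Pref B) (PB : B → Pref A) :
    ProposingInv PA PB (fun _ => none) (fun _ => ∅) where
  injective := by simp
  isFavourite := by simp
  exists_lt := by simp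

open Classical in
theorem proposeFree (h : ProposingInv PA PB held declined) {a : A} {b : B}
    (hfree : ∀ b', held b' ≠ some a) (hfav : (PA a).IsFavourite (declined a)ᶜ b)
    (hheld : held b = none) :
    ProposingInv PA PB (Function.update held b (some a)) declined where
  injective x y z hy hz := by
    rw [Function.update_apply] at hy hz
    split_ifs at hy hz with h₁ h₂ h₂
    · rw [h₁, h₂]
    · cases hy; exact absurd hz (hfree z)
    · cases hz; exact absurd hy (hfree y)
    · exact h.injective x y z hy hz
  isFavourite x y hy := by
    rw [Function.update_apply] at hy
    split_ifs at hy with h₁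
    · cases hy; subst h₁; exact hfav
    · exact h.isFavourite x y hy
  exists_lt x y hy := by
    obtain ⟨a', ha', hlt⟩ := h.exists_lt x y hy
    refine ⟨a', ?_, hlt⟩
    rw [Function.update_of_ne, ha']
    rintro rfl
    simp [hheld] at ha'

open Classical in
theorem proposeAccepted (h : ProposingInv PA PB held declined) {a a' : A} {b : B}
    (hfree : ∀ b', held b' ≠ some a) (hfav : (PA a).IsFavourite (declined a)ᶜ b)
    (hheld : held b = some a') (hlt : (PB b).lt a a') :
    ProposingInv PA PB (Function.update held b (some a))
      (Function.update declined a' (insert b (declined a'))) where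
  injective x y z hy hz := by
    rw [Function.update_apply] at hy hz
    split_ifs at hy hz with h₁ h₂ h₂
    · rw [h₁, h₂]
    · cases hy; exact absurd hz (hfree z)
    · cases hz; exact absurd hy (hfree y)
    · exact h.injective x y z hy hz
  isFavourite x y hy := by
    rw [Function.update_apply] at hy
    split_ifs at hy with h₁
    · cases hy
      subst h₁
      rwa [Function.update_of_ne ((PB y).ne_of_lt hlt)]
    · rw [Function.update_of_ne]
      · exact h.isFavourite x y hy
      · rintro rfl
        exact h₁ (h.injective _ _ _ hy hheld)
  exists_lt x y hy := by
    have hy' : y ∈ declined x ∨ (x = a' ∧ y = b) := by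
      rw [Function.update_apply] at hy
      split_ifs at hy with h₁
      · subst h₁
        rcases hy with hy | hy
        · exact .inr ⟨rfl, hy⟩
        · exact .inl hy
      · exact .inl hy
    rcases hy' with hy' | ⟨rfl, rfl⟩
    · obtain ⟨z, hz, hzx⟩ := h.exists_lt x y hy'
      by_cases hyb : y = b
      · subst hyb
        rw [hheld] at hz
        cases hz
        exact ⟨a, by simp, (PB y).trans hlt hzx⟩
      · exact ⟨z, by rwa [Function.update_of_ne hyb], hzx⟩
    · exact ⟨a, by simp, hlt⟩

open Classical in
theorem proposeRejected (h : ProposingInv PA PB held declined) {a a' : A} {b : B}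
    (hfree : ∀ b', held b' ≠ some a) (hheld : held b = some a') (hlt : (PB b).lt a' a) :
    ProposingInv PA PB held (Function.update declined a (insert b (declined a))) where
  injective := h.injective
  isFavourite x y hy := by
    rw [Function.update_of_ne]
    · exact h.isFavourite x y hy
    · rintro rfl
      exact hfree y hy
  exists_lt x y hy := by
    rw [Function.update_apply] at hy
    split_ifs at hy with h₁
    · subst h₁
      rcases hy with rfl | hy
      · exact ⟨a', hheld, hlt⟩
      · exact h.exists_lt _ _ hy
    · exact h.exists_lt _ _ hy

theorem isStable (h : ProposingInv PA PB held declined) {M : A ≃ B}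
    (hM : ∀ a, held (M a) = some a) : IsStable PA PB M := by
  refine isStable_of_forall_lt fun a b hab => ?_
  have hb : b ∈ declined a := by
    by_contra hb
    exact (h.isFavourite a (M a) (hM a)).2 b hb hab
  obtain ⟨a', ha', hlt⟩ := h.exists_lt a b hb
  have := hM (M.symm b)
  rw [Equiv.apply_symm_apply, ha'] at this
  cases this
  exact (PB b).asymm hlt

/-- If all of `B` had rejected `a`, all of `B` would hold someone; as `held` is injective and the
sides have equal size, `a` would be held as well. -/
theorem exists_isFavourite [Fintype A] [Fintype B] (hAB : Fintype.card A = Fintype.card B)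
    (h : ProposingInv PA PB held declined) {a : A} (hfree : ∀ b, held b ≠ some a) :
    ∃ b, (PA a).IsFavourite (declined a)ᶜ b := by
  refine (PA a).exists_isFavourite ?_
  by_contra hempty
  rw [Set.not_nonempty_iff_eq_empty, Set.compl_empty_iff] at hempty
  choose f hf using fun b => h.exists_lt a b (hempty ▸ Set.mem_univ b)
  have hinj : Function.Injective f := fun b b' hbb =>
    h.injective _ b b' (hf b).1 (hbb ▸ (hf b').1)
  have hbij := (Fintype.bijective_iff_injective_and_card f).2 ⟨hinj, hAB.symm⟩
  obtain ⟨b, rfl⟩ := hbij.2 a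
  exact hfree b (hf b).1

theorem exists_step [Fintype A] [Fintype B] (hAB : Fintype.card A = Fintype.card B)
    (h : ProposingInv PA PB held declined) :
    ∃ e s', AlgStep PA (.proposing held declined) e s' ∧ e.Truthful PB := by
  by_cases hall : ∀ a, ∃ b, held b = some a
  · choose f hf using hall
    have hinj : Function.Injective f := fun a a' haa => by
      have := hf a
      rw [haa, hf a'] at this
      exact (Option.some.inj this).symm
    have hbij := (Fintype.bijective_iff_injective_and_card f).2 ⟨hinj, hAB⟩
    exact ⟨_, _, .startSearch (M := Equiv.ofBijective f hbij) hf, trivial⟩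
  · push Not at hall
    obtain ⟨a, hfree⟩ := hall
    obtain ⟨b, hfav⟩ := h.exists_isFavourite hAB hfree
    rcases hheld : held b with _ | a'
    · exact ⟨_, _, .proposeFree hfree hfav hheld, trivial⟩
    · rcases prefer_eq_or PB b a a' with hp | hp
      · exact ⟨_, _, .proposeAccepted hfree hfav hheld, hp.symm⟩
      · exact ⟨_, _, .proposeRejected hfree hfav hheld, hp.symm⟩

end ProposingInv

/-! ### The search for rotations -/

/-- The invariant of the search for rotations. -/
structure SearchInv (PA : A → Pref B) (PB : B → Pref A) (s : SearchState A B) : Prop where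
  isStable : IsStable PA PB s.M
  exists_p : ∀ a ∉ s.N, ∃ b, s.p a = some b
  lt_p : ∀ a ∉ s.N, ∀ b, s.p a = some b → (PA a).lt (s.M a) b
  lt_of_lt_p : ∀ a ∉ s.N, ∀ b, s.p a = some b → ∀ b', (PA a).lt (s.M a) b' → (PA a).lt b' b →
    (PB b').lt (s.M.symm b') a
  lt_of_mem_N : ∀ a ∈ s.N, ∀ b, (PA a).lt (s.M a) b → (PB b).lt (s.M.symm b) a
  of_r : ∀ a ∉ s.N, ∀ b, s.r a = some b → s.p a = some b ∧ (PB b).lt a (s.M.symm b)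
  exists_r : ∀ a ∉ s.N, a ∉ s.todo → s.cur ≠ some a → ∃ b, s.r a = some b
  notMem_N_of_todo : ∀ a ∈ s.todo, a ∉ s.N
  r_of_todo : ∀ a ∈ s.todo, s.r a = none
  notMem_N_of_cur : ∀ a, s.cur = some a → a ∉ s.N
  notMem_todo_of_cur : ∀ a, s.cur = some a → a ∉ s.todo
  r_of_cur : ∀ a, s.cur = some a → s.r a = none

namespace SearchInv

variable {s : SearchState A B}

theorem init [Finite B] {M : A ≃ B} (hM : IsStable PA PB M) :
    SearchInv PA PB (SearchState.init PA M) where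
  isStable := hM
  exists_p a ha := Option.ne_none_iff_exists'.1 ha
  lt_p a ha b hb := (Pref.isDirectSucc_of_next_eq_some hb).1
  lt_of_lt_p a ha b hb b' h h' := absurd h' ((Pref.isDirectSucc_of_next_eq_some hb).2 b' h)
  lt_of_mem_N a ha b h := absurd h (Pref.not_lt_of_next_eq_none ha b)
  of_r a ha b hb := by simp [SearchState.init] at hb
  exists_r a ha ha' := absurd ha ha'
  notMem_N_of_todo a ha := ha
  r_of_todo a ha := rfl
  notMem_N_of_cur a ha := by simp [SearchState.init] at ha
  notMem_todo_of_cur a ha := by simp [SearchState.init] at ha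
  r_of_cur a ha := rfl

theorem consider (h : SearchInv PA PB s) {a : A} (hcur : s.cur = none) (ha : a ∈ s.todo) :
    SearchInv PA PB { s with todo := s.todo \ {a}, cur := some a } where
  isStable := h.isStable
  exists_p := h.exists_p
  lt_p := h.lt_p
  lt_of_lt_p := h.lt_of_lt_p
  lt_of_mem_N := h.lt_of_mem_N
  of_r := h.of_r
  exists_r x hx hx' hne := by
    refine h.exists_r x hx (fun hx'' => hx' ⟨hx'', ?_⟩) (by simp [hcur])
    rintro rfl
    exact hne rfl
  notMem_N_of_todo x hx := h.notMem_N_of_todo x hx.1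
  r_of_todo x hx := h.r_of_todo x hx.1
  notMem_N_of_cur x hx := by
    cases hx
    exact h.notMem_N_of_todo a ha
  notMem_todo_of_cur x hx := by
    cases hx
    simp
  r_of_cur x hx := by
    cases hx
    exact h.r_of_todo a ha

open Classical in
theorem searchOn (h : SearchInv PA PB s) {a : A} {b b' : B} (hcur : s.cur = some a)
    (hp : s.p a = some b) (hnext : (PA a).next b = some b') (hlt : (PB b).lt (s.M.symm b) a) :
    SearchInv PA PB { s with p := Function.update s.p a (some b') } where
  isStable := h.isStable
  exists_p x hx := by
    by_cases hxa : x = a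
    · subst hxa
      exact ⟨b', by simp⟩
    · simpa [Function.update_of_ne hxa] using h.exists_p x hx
  lt_p x hx y hy := by
    by_cases hxa : x = a
    · subst hxa
      simp only [Function.update_self, Option.some.injEq] at hy
      subst hy
      exact (PA x).trans (h.lt_p x hx b hp) (Pref.isDirectSucc_of_next_eq_some hnext).1
    · simp only [Function.update_of_ne hxa] at hy
      exact h.lt_p x hx y hy
  lt_of_lt_p x hx y hy z hz hz' := by
    by_cases hxa : x = a
    · subst hxa
      simp only [Function.update_self, Option.some.injEq] at hy
      subst hy
      have := (Pref.isDirectSucc_of_next_eq_some hnext).2 z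
      rcases (PA x).eq_or_lt_of_not_lt fun h' => this h' hz' with rfl | hzb
      · exact hlt
      · exact h.lt_of_lt_p x hx b hp z hz hzb
    · simp only [Function.update_of_ne hxa] at hy
      exact h.lt_of_lt_p x hx y hy z hz hz'
  lt_of_mem_N := h.lt_of_mem_N
  of_r x hx y hy := by
    have hxa : x ≠ a := by
      rintro rfl
      simp [h.r_of_cur x hcur] at hy
    simpa [Function.update_of_ne hxa] using h.of_r x hx y hy
  exists_r := h.exists_r
  notMem_N_of_todo := h.notMem_N_of_todo
  r_of_todo := h.r_of_todo
  notMem_N_of_cur := h.notMem_N_of_cur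
  notMem_todo_of_cur := h.notMem_todo_of_cur
  r_of_cur := h.r_of_cur

theorem searchExhausted [Finite B] (h : SearchInv PA PB s) {a : A} {b : B} (hcur : s.cur = some a)
    (hp : s.p a = some b) (hlast : (PA a).next b = none) (hlt : (PB b).lt (s.M.symm b) a) :
    SearchInv PA PB { s with N := insert a s.N, cur := none } where
  isStable := h.isStable
  exists_p x hx := h.exists_p x fun hx' => hx (.inr hx')
  lt_p x hx := h.lt_p x fun hx' => hx (.inr hx')
  lt_of_lt_p x hx := h.lt_of_lt_p x fun hx' => hx (.inr hx')
  lt_of_mem_N x hx y hy := by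
    rcases hx with rfl | hx
    · rcases (PA x).eq_or_lt_of_not_lt (Pref.not_lt_of_next_eq_none hlast y) with rfl | hyb
      · exact hlt
      · exact h.lt_of_lt_p x (h.notMem_N_of_cur x hcur) b hp y hy hyb
    · exact h.lt_of_mem_N x hx y hy
  of_r x hx := h.of_r x fun hx' => hx (.inr hx')
  exists_r x hx hx' _ := by
    refine h.exists_r x (fun hx' => hx (.inr hx')) hx' fun hx'' => hx (.inl ?_)
    rw [hcur] at hx''
    exact (Option.some.inj hx'').symm
  notMem_N_of_todo x hx hx' := by
    rcases hx' with rfl | hx'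
    · exact h.notMem_todo_of_cur x hcur hx
    · exact h.notMem_N_of_todo x hx hx'
  r_of_todo := h.r_of_todo
  notMem_N_of_cur x hx := by simp at hx
  notMem_todo_of_cur x hx := by simp at hx
  r_of_cur x hx := by simp at hx

open Classical in
theorem searchFound (h : SearchInv PA PB s) {a : A} {b : B} (hcur : s.cur = some a)
    (hp : s.p a = some b) (hlt : (PB b).lt a (s.M.symm b)) :
    SearchInv PA PB { s with r := Function.update s.r a (some b), cur := none } where
  isStable := h.isStable
  exists_p := h.exists_p
  lt_p := h.lt_p
  lt_of_lt_p := h.lt_of_lt_p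
  lt_of_mem_N := h.lt_of_mem_N
  of_r x hx y hy := by
    by_cases hxa : x = a
    · subst hxa
      simp only [Function.update_self, Option.some.injEq] at hy
      subst hy
      exact ⟨hp, hlt⟩
    · simp only [Function.update_of_ne hxa] at hy
      exact h.of_r x hx y hy
  exists_r x hx hx' _ := by
    by_cases hxa : x = a
    · subst hxa
      exact ⟨b, by simp⟩
    · simp only [Function.update_of_ne hxa]
      refine h.exists_r x hx hx' fun hx'' => hxa ?_
      rw [hcur] at hx''
      exact (Option.some.inj hx'').symm
  notMem_N_of_todo := h.notMem_N_of_todo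
  r_of_todo x hx := by
    have hxa : x ≠ a := by
      rintro rfl
      exact h.notMem_todo_of_cur x hcur hx
    simpa [Function.update_of_ne hxa] using h.r_of_todo x hx
  notMem_N_of_cur x hx := by simp at hx
  notMem_todo_of_cur x hx := by simp at hx
  r_of_cur x hx := by simp at hx

/-! #### Applying a rotation -/

section Rotation

variable {m : ℕ} {R : Fin (m + 1) → A} {M' : A ≃ B}

theorem lt_of_isApplied (h : SearchInv PA PB s) (hR : s.IsRotation R) (hM' : s.IsApplied R M')
    {a : A} (ha : a ∈ Set.range R) : (PA a).lt (s.M a) (M' a) := by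
  obtain ⟨k, rfl⟩ := ha
  exact h.lt_p _ (hR.2 k).1 _ (h.of_r _ (hR.2 k).1 _ (hM'.1 k)).1

theorem symm_of_isApplied (h : SearchInv PA PB s) (hR : s.IsRotation R) (hM' : s.IsApplied R M')
    (b : B) : M'.symm b = s.M.symm b ∨ (PB b).lt (M'.symm b) (s.M.symm b) := by
  obtain ⟨a, rfl⟩ := M'.surjective b
  rw [Equiv.symm_apply_apply]
  by_cases ha : a ∈ Set.range R
  · obtain ⟨k, rfl⟩ := ha
    exact .inr (h.of_r _ (hR.2 k).1 _ (hM'.1 k)).2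
  · left
    rw [hM'.2 a ha, Equiv.symm_apply_apply]

/-- Rejections survive rotations, since partners on the `B`-side only improve. This is why the
search need not go back on the lists. -/
theorem lt_symm_of_isApplied (h : SearchInv PA PB s) (hR : s.IsRotation R)
    (hM' : s.IsApplied R M') {a : A} {b : B} (hlt : (PB b).lt (s.M.symm b) a) :
    (PB b).lt (M'.symm b) a := by
  rcases h.symm_of_isApplied hR hM' b with hb | hb
  · rwa [hb]
  · exact (PB b).trans hb hlt

/-- If `a` prefers `b` to `M' a`, then `b` comes before `s.M a`, equals it, or lies strictly between
it and the `r`-edge `M' a`. In the first case stability of `s.M` gives a rejection, in the last the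
search has recorded one; in the middle case `b` has not become worse off than with `a`. -/
theorem isStable_of_isApplied (h : SearchInv PA PB s) (hR : s.IsRotation R)
    (hM' : s.IsApplied R M') : IsStable PA PB M' := by
  refine isStable_of_forall_lt fun a b hab => ?_
  by_cases hlt : (PA a).lt b (s.M a)
  · exact (PB b).asymm (h.lt_symm_of_isApplied hR hM' (h.isStable.lt_of_lt hlt))
  have ha : a ∈ Set.range R := by
    by_contra ha
    rw [hM'.2 a ha] at hab
    exact hlt hab
  rcases (PA a).eq_or_lt_of_not_lt hlt with hb | hb
  · subst hb
    have := h.symm_of_isApplied hR hM' (s.M a)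
    rw [Equiv.symm_apply_apply] at this
    rcases this with h' | h'
    · rw [h']
      exact (PB _).irrefl a
    · exact (PB _).asymm h'
  · obtain ⟨k, rfl⟩ := ha
    have hN := (hR.2 k).1
    exact (PB b).asymm (h.lt_symm_of_isApplied hR hM'
      (h.lt_of_lt_p _ hN _ (h.of_r _ hN _ (hM'.1 k)).1 b hb hab))

/-- Off the rotation the reset of `p` to `r` changes nothing: when the loop is over, every agent
outside `N` has an `r`-edge, and it is at `p`. -/
theorem p_afterRotation (h : SearchInv PA PB s) (hcur : s.cur = none) (htodo : s.todo = ∅)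
    (hM' : s.IsApplied R M') {a : A} (ha : a ∉ s.newN PA (Set.range R) M') :
    (a ∈ Set.range R ∧ ∃ b, (s.afterRotation PA (Set.range R) M').p a = some b ∧
        (PA a).IsDirectSucc (M' a) b) ∨
      (a ∉ Set.range R ∧ (s.afterRotation PA (Set.range R) M').p a = s.p a ∧ M' a = s.M a) := by
  by_cases haR : a ∈ Set.range R
  · left
    refine ⟨haR, ?_⟩
    obtain ⟨b, hb⟩ : ∃ b, (PA a).next (M' a) = some b :=
      Option.ne_none_iff_exists'.1 fun hnone => ha (.inr ⟨haR, hnone⟩)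
    refine ⟨b, ?_, Pref.isDirectSucc_of_next_eq_some hb⟩
    simp only [SearchState.afterRotation, if_neg ha, if_pos haR, hb]
  · right
    refine ⟨haR, ?_, hM'.2 a haR⟩
    simp only [SearchState.afterRotation, if_neg ha, if_neg haR]
    have haN : a ∉ s.N := fun h' => ha (.inl h')
    obtain ⟨b, hb⟩ := h.exists_r a haN (by simp [htodo]) (by simp [hcur])
    rw [hb, (h.of_r a haN b hb).1]

theorem rotate [Finite B] (h : SearchInv PA PB s) (hcur : s.cur = none) (htodo : s.todo = ∅)
    (hR : s.IsRotation R) (hM' : s.IsApplied R M') :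
    SearchInv PA PB (s.afterRotation PA (Set.range R) M') where
  isStable := h.isStable_of_isApplied hR hM'
  exists_p a ha := by
    rcases h.p_afterRotation hcur htodo hM' ha with ⟨-, b, hb, -⟩ | ⟨-, hp, -⟩
    · exact ⟨b, hb⟩
    · rw [hp]
      exact h.exists_p a fun h' => ha (.inl h')
  lt_p a ha b hb := by
    change (PA a).lt (M' a) b
    rcases h.p_afterRotation hcur htodo hM' ha with ⟨-, b', hb', hlt⟩ | ⟨-, hp, hMa⟩
    · rw [hb'] at hb
      cases hb
      exact hlt.1
    · rw [hp] at hb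
      rw [hMa]
      exact h.lt_p a (fun h' => ha (.inl h')) b hb
  lt_of_lt_p a ha b hb y hy hyb := by
    change (PA a).lt (M' a) y at hy
    rcases h.p_afterRotation hcur htodo hM' ha with ⟨-, b', hb', hlt⟩ | ⟨-, hp, hMa⟩
    · rw [hb'] at hb
      cases hb
      exact absurd hyb (hlt.2 y hy)
    · rw [hp] at hb
      rw [hMa] at hy
      exact h.lt_symm_of_isApplied hR hM'
        (h.lt_of_lt_p a (fun h' => ha (.inl h')) b hb y hy hyb)
  lt_of_mem_N a ha b hb := by
    change (PA a).lt (M' a) b at hb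
    rcases ha with ha | ha
    · have haR : a ∉ Set.range R := by
        rintro ⟨k, rfl⟩
        exact (hR.2 k).1 ha
      rw [hM'.2 a haR] at hb
      exact h.lt_symm_of_isApplied hR hM' (h.lt_of_mem_N a ha b hb)
    · exact absurd hb (Pref.not_lt_of_next_eq_none ha.2 b)
  of_r a ha b hb := by
    have ha' : a ∉ s.newN PA (Set.range R) M' := ha
    simp [SearchState.afterRotation, ha'] at hb
  exists_r a ha ha' := absurd ha ha'
  notMem_N_of_todo a ha := ha
  r_of_todo a ha := by
    have ha' : a ∉ s.newN PA (Set.range R) M' := ha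
    simp [SearchState.afterRotation, ha']
  notMem_N_of_cur a ha := by simp [SearchState.afterRotation] at ha
  notMem_todo_of_cur a ha := by simp [SearchState.afterRotation] at ha
  r_of_cur a ha := by simp [SearchState.afterRotation] at ha

theorem exists_isApplied (hR : s.IsRotation R) : ∃ M' : A ≃ B, s.IsApplied R M' := by
  let ι : Fin (m + 1) ↪ A := ⟨R, hR.1⟩
  -- The cyclic shift of the indices, carried to `A` along `R` and extended by the identity,
  -- followed by the old matching.
  refine ⟨((Equiv.addRight (1 : Fin (m + 1))).viaEmbedding ι).trans s.M, fun k => ?_,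
    fun a ha => ?_⟩
  · have := Equiv.Perm.viaEmbedding_apply (Equiv.addRight (1 : Fin (m + 1))) ι k
    rw [(hR.2 k).2, Equiv.trans_apply]
    exact congrArg (fun x => some (s.M x)) this.symm
  · have := Equiv.Perm.viaEmbedding_apply_of_notMem (Equiv.addRight (1 : Fin (m + 1))) ι a ha
    rw [Equiv.trans_apply, this]

end Rotation

theorem exists_step (h : SearchInv PA PB s) :
    ∃ e s', AlgStep PA (.searching s) e s' ∧ e.Truthful PB := by
  rcases hcur : s.cur with _ | a
  · rcases s.todo.eq_empty_or_nonempty with htodo | ⟨a, ha⟩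
    · by_cases hrot : ∃ (m : ℕ) (R : Fin (m + 1) → A), s.IsRotation R
      · obtain ⟨m, R, hR⟩ := hrot
        obtain ⟨M', hM'⟩ := exists_isApplied hR
        exact ⟨_, _, .rotate hcur htodo hR hM', trivial⟩
      · exact ⟨_, _, .finish hcur htodo hrot, trivial⟩
    · exact ⟨_, _, .consider hcur ha, trivial⟩
  · obtain ⟨b, hp⟩ := h.exists_p a (h.notMem_N_of_cur a hcur)
    rcases prefer_eq_or PB b a (s.M.symm b) with hpr | hpr
    · exact ⟨_, _, .searchFound hcur hp, hpr.symm⟩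
    · rcases hnext : (PA a).next b with _ | b'
      · exact ⟨_, _, .searchExhausted hcur hp hnext, hpr.symm⟩
      · exact ⟨_, _, .searchOn hcur hp hnext, hpr.symm⟩

/-- Queries of the search compare distinct agents, so that their answers express strict preferences.
-/
theorem ne_symm_p (h : SearchInv PA PB s) {a : A} {b : B} (ha : a ∉ s.N) (hp : s.p a = some b) :
    a ≠ s.M.symm b := by
  rintro rfl
  have := h.lt_p _ ha b hp
  rw [Equiv.apply_symm_apply] at this
  exact (PA _).irrefl b this

end SearchInv

/-! ### A stable matching without rotations is `B`-optimal -/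

/-- If `M` and `M'` are stable, then both matchings map the agents of `A` that prefer `M` onto the
agents of `B` that prefer `M'`. -/
theorem IsStable.image_eq [Finite A] {M M' : A ≃ B} (hM : IsStable PA PB M)
    (hM' : IsStable PA PB M') :
    M '' {a | (PA a).lt (M a) (M' a)} = {b | (PB b).lt (M'.symm b) (M.symm b)} ∧
      M'.symm '' {b | (PB b).lt (M'.symm b) (M.symm b)} = {a | (PA a).lt (M a) (M' a)} := by
  have : Finite B := Finite.of_equiv A M
  set D : Set A := {a | (PA a).lt (M a) (M' a)}
  set W : Set B := {b | (PB b).lt (M'.symm b) (M.symm b)}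
  have hDW : M '' D ⊆ W := by
    rintro _ ⟨x, hx, rfl⟩
    have := hM'.lt_of_lt hx
    simpa [W] using this
  have hWD : M'.symm '' W ⊆ D := by
    rintro _ ⟨y, hy, rfl⟩
    refine (PA _).lt_of_not_lt (fun heq => ?_) fun hlt => ?_
    · rw [Equiv.apply_symm_apply] at heq
      apply (PB y).ne_of_lt hy
      exact ((Equiv.symm_apply_eq M).2 heq).symm
    · rw [Equiv.apply_symm_apply] at hlt
      exact (PB y).asymm hy (hM.lt_of_lt hlt)
  -- The two injections give `|D| ≤ |W| ≤ |D|`, so both inclusions are equalities.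
  have hD := Set.ncard_image_of_injective D M.injective
  have hW := Set.ncard_image_of_injective W M'.symm.injective
  have hDW' := Set.ncard_le_ncard hDW (Set.toFinite W)
  have hWD' := Set.ncard_le_ncard hWD (Set.toFinite D)
  exact ⟨Set.eq_of_subset_of_ncard_le hDW (by omega) (Set.toFinite W),
    Set.eq_of_subset_of_ncard_le hWD (by omega) (Set.toFinite D)⟩

/-- Stability says nothing directly about `M' a` here; the surjectivity obtained by counting in
`image_eq` is needed. -/
theorem IsStable.lt_symm_of_lt [Finite A] {M M' : A ≃ B} (hM : IsStable PA PB M)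
    (hM' : IsStable PA PB M') {a : A} (ha : (PA a).lt (M a) (M' a)) :
    (PB (M' a)).lt a (M.symm (M' a)) := by
  obtain ⟨b, hb, rfl⟩ := (hM.image_eq hM').2.superset ha
  have hb' : (PB b).lt (M'.symm b) (M.symm b) := hb
  simpa using hb'

theorem IsStable.lt_of_lt_symm [Finite A] {M M' : A ≃ B} (hM : IsStable PA PB M)
    (hM' : IsStable PA PB M') {b : B} (hb : (PB b).lt (M'.symm b) (M.symm b)) :
    (PA (M.symm b)).lt (M (M.symm b)) (M' (M.symm b)) := by
  obtain ⟨a, ha, rfl⟩ := (hM.image_eq hM').1.superset hb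
  have ha' : (PA a).lt (M a) (M' a) := ha
  simpa using ha'

/-- A cycle of a self-map, as an injective sequence indexed by `Fin (m + 1)`. -/
theorem exists_cycle {X : Type u} [Finite X] (g : X → X) (x : X) :
    ∃ (m : ℕ) (R : Fin (m + 1) → X), Function.Injective R ∧ (∀ k, R (k + 1) = g (R k)) ∧
      ∀ k, ∃ i, R k = g^[i] x := by
  obtain ⟨i, j, hij, heq⟩ :
      ∃ i j : ℕ, i < j ∧ g^[i] x = g^[j] x := by
    obtain ⟨i, j, hne, heq⟩ := Finite.exists_ne_map_eq_of_infinite fun i : ℕ => g^[i] x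
    rcases lt_or_gt_of_ne hne with h | h
    · exact ⟨i, j, h, heq⟩
    · exact ⟨j, i, h, heq.symm⟩
  set y := g^[i] x with hy
  have hper : y ∈ Function.periodicPts g := by
    refine ⟨j - i, by omega, ?_⟩
    change g^[j - i] y = y
    rw [hy, ← Function.iterate_add_apply, Nat.sub_add_cancel hij.le, ← heq]
  have hpos := Function.minimalPeriod_pos_iff_mem_periodicPts.2 hper
  obtain ⟨m, hm⟩ := Nat.exists_eq_succ_of_ne_zero hpos.ne'
  -- The point `y`, where the orbit of `x` meets itself, is periodic, and `m + 1` is its minimal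
  -- period; this gives injectivity and lets `k + 1` wrap around.
  refine ⟨m, fun k => g^[(k : ℕ)] y, fun k l hkl => ?_, fun k => ?_, fun k => ⟨k + i, ?_⟩⟩
  · refine Fin.ext (Function.iterate_injOn_Iio_minimalPeriod (f := g) (x := y) ?_ ?_ hkl)
    · rw [Set.mem_Iio, hm]
      exact k.2
    · rw [Set.mem_Iio, hm]
      exact l.2
  · dsimp only
    rw [← Function.iterate_succ_apply' g,
      ← Function.iterate_mod_minimalPeriod_eq (n := (k : ℕ).succ), hm, Fin.val_add, Fin.val_one', Nat.add_mod_mod]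
  · rw [Function.iterate_add_apply]

/-- Let `M'` be stable and better for `b`, and let `D` be the set of agents of `A` that prefer `s.M`
to `M'`. Each `a ∈ D` has an `r`-edge, and the partner in `s.M` of its endpoint is again in `D`. A
cycle of this self-map of `D`, reached from the partner of `b`, is a rotation. -/
theorem SearchInv.isBOptimal [Finite A] {s : SearchState A B} (h : SearchInv PA PB s)
    (hcur : s.cur = none) (htodo : s.todo = ∅)
    (hno : ¬ ∃ (m : ℕ) (R : Fin (m + 1) → A), s.IsRotation R) : IsBOptimal PA PB s.M := by
  refine ⟨h.isStable, fun M' hM' b hb => hno ?_⟩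
  have hstep : ∀ a, (PA a).lt (s.M a) (M' a) → a ∉ s.N ∧ ∃ c, s.r a = some c ∧
      (PA (s.M.symm c)).lt (s.M (s.M.symm c)) (M' (s.M.symm c)) := by
    intro a ha
    have hWa := h.isStable.lt_symm_of_lt hM' ha
    have haN : a ∉ s.N := fun haN => (PB _).asymm hWa (h.lt_of_mem_N a haN _ ha)
    obtain ⟨c, hc⟩ := h.exists_r a haN (by simp [htodo]) (by simp [hcur])
    obtain ⟨hp, hlt⟩ := h.of_r a haN c hc
    have hcle : ¬ (PA a).lt (M' a) c := fun h' =>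
      (PB _).asymm hWa (h.lt_of_lt_p a haN c hp _ ha h')
    -- The `r`-edge `c` is not beyond `M' a`, who would accept `a`. If `a` prefers `c` to `M' a`,
    -- then in `M'` the agent `c` has someone better than `a`, whom it already prefers to its
    -- current partner.
    have hcW : (PB c).lt (M'.symm c) (s.M.symm c) := by
      rcases (PA a).eq_or_lt_of_not_lt hcle with rfl | h'
      · simpa using hWa
      · exact (PB c).trans (hM'.lt_of_lt h') hlt
    exact ⟨haN, c, hc, h.isStable.lt_of_lt_symm hM' hcW⟩
  have : Nonempty B := ⟨b⟩
  choose! hN f hr hf using hstep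
  obtain ⟨m, R, hinj, hsucc, hiter⟩ :=
    exists_cycle (fun a => s.M.symm (f a)) (s.M.symm b)
  have hD : ∀ i, (PA ((fun a => s.M.symm (f a))^[i] (s.M.symm b))).lt
      (s.M ((fun a => s.M.symm (f a))^[i] (s.M.symm b)))
      (M' ((fun a => s.M.symm (f a))^[i] (s.M.symm b))) := by
    intro i
    induction i with
    | zero => exact h.isStable.lt_of_lt_symm hM' hb
    | succ i ih =>
      rw [Function.iterate_succ_apply']
      exact hf _ ih
  have hDR : ∀ k, (PA (R k)).lt (s.M (R k)) (M' (R k)) := by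
    intro k
    obtain ⟨i, hi⟩ := hiter k
    rw [hi]
    exact hD i
  refine ⟨m, R, hinj, fun k => ⟨hN _ (hDR k), ?_⟩⟩
  rw [hsucc, Equiv.apply_symm_apply]
  exact hr _ (hDR k)

/-! ### The invariant of the whole algorithm -/

/-- The invariant of the algorithm. -/
def AlgInv (PA : A → Pref B) (PB : B → Pref A) : AlgState A B → Prop
  | .proposing held declined => ProposingInv PA PB held declined
  | .searching s => SearchInv PA PB s
  | .halted M => IsBOptimal PA PB M

theorem AlgInv.step [Finite A] [Finite B] {s s' : AlgState A B} {e : Event A B}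
    (h : AlgInv PA PB s) (hs : AlgStep PA s e s') (he : e.Truthful PB) : AlgInv PA PB s' := by
  cases hs with
  | proposeFree hfree hfav hheld => exact ProposingInv.proposeFree h hfree hfav hheld
  | proposeAccepted hfree hfav hheld =>
    exact ProposingInv.proposeAccepted h hfree hfav hheld
      ((prefer_eq_left_iff (by rintro rfl; exact hfree _ hheld)).1 he.symm)
  | proposeRejected hfree hfav hheld =>
    exact ProposingInv.proposeRejected h hfree hheld
      ((prefer_eq_right_iff (by rintro rfl; exact hfree _ hheld)).1 he.symm)
  | startSearch hM => exact SearchInv.init (ProposingInv.isStable h hM)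
  | consider hcur ha => exact SearchInv.consider h hcur ha
  | searchOn hcur hp hnext =>
    have hne := SearchInv.ne_symm_p h (SearchInv.notMem_N_of_cur h _ hcur) hp
    exact SearchInv.searchOn h hcur hp hnext ((prefer_eq_right_iff hne).1 he.symm)
  | searchExhausted hcur hp hlast =>
    have hne := SearchInv.ne_symm_p h (SearchInv.notMem_N_of_cur h _ hcur) hp
    exact SearchInv.searchExhausted h hcur hp hlast ((prefer_eq_right_iff hne).1 he.symm)
  | searchFound hcur hp =>
    have hne := SearchInv.ne_symm_p h (SearchInv.notMem_N_of_cur h _ hcur) hp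
    exact SearchInv.searchFound h hcur hp ((prefer_eq_left_iff hne).1 he.symm)
  | rotate hcur htodo hR hM' => exact SearchInv.rotate h hcur htodo hR hM'
  | finish hcur htodo hno => exact SearchInv.isBOptimal h hcur htodo hno

/-- A state in which the algorithm is stuck is halted, with a `B`-optimal matching. -/
theorem AlgInv.exists_output [Fintype A] [Fintype B] (hAB : Fintype.card A = Fintype.card B)
    {s : AlgState A B} (h : AlgInv PA PB s)
    (hstuck : ¬ ∃ e s', AlgStep PA s e s' ∧ e.Truthful PB) :
    ∃ M, algOutput s = some M ∧ IsBOptimal PA PB M := by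
  cases s with
  | proposing held declined => exact absurd (ProposingInv.exists_step hAB h) hstuck
  | searching s => exact absurd (SearchInv.exists_step h) hstuck
  | halted M => exact ⟨M, rfl, h⟩

/-- With at most one agent on each side, no queries are made. -/
theorem AlgInv.cost_eq_zero [Subsingleton A] {s s' : AlgState A B} {e : Event A B}
    (h : AlgInv PA PB s) (hs : AlgStep PA s e s') : e.cost = 0 := by
  have hsearch : ∀ {t : SearchState A B} {a : A} {b : B}, SearchInv PA PB t → t.cur = some a →
      t.p a = some b → False := fun ht hcur hp =>
    ht.ne_symm_p (ht.notMem_N_of_cur _ hcur) hp (Subsingleton.elim _ _)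
  cases hs with
  | proposeAccepted hfree _ hheld =>
    exact absurd (hheld.trans (congrArg some (Subsingleton.elim _ _))) (hfree _)
  | proposeRejected hfree _ hheld =>
    exact absurd (hheld.trans (congrArg some (Subsingleton.elim _ _))) (hfree _)
  | searchOn hcur hp _ => exact (hsearch h hcur hp).elim
  | searchExhausted hcur hp _ => exact (hsearch h hcur hp).elim
  | searchFound hcur hp => exact (hsearch h hcur hp).elim
  | _ => rfl

/-! ### A potential that every step increases -/

section Potential

variable [Fintype B]

open Classical in
/-- How far the search for an `r`-edge of `a` has got on the list of `a`. -/
noncomputable def progress (PA : A → Pref B) (s : SearchState A B) (a : A) : ℕ :=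
  if a ∈ s.N then Fintype.card B else (s.p a).elim 0 (PA a).rank

theorem progress_le (PA : A → Pref B) (s : SearchState A B) (a : A) :
    progress PA s a ≤ Fintype.card B := by
  unfold progress
  split_ifs
  · rfl
  · rcases s.p a with _ | b
    · exact Nat.zero_le _
    · exact ((PA a).rank_lt_card b).le

theorem progress_of_mem {s : SearchState A B} {a : A} (ha : a ∈ s.N) :
    progress PA s a = Fintype.card B :=
  if_pos ha

theorem progress_of_notMem {s : SearchState A B} {a : A} {b : B} (ha : a ∉ s.N)
    (hb : s.p a = some b) : progress PA s a = (PA a).rank b := by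
  simp [progress, ha, hb]

theorem SearchInv.progress_le_afterRotation {s : SearchState A B} (h : SearchInv PA PB s)
    (hcur : s.cur = none) (htodo : s.todo = ∅) {m : ℕ} {R : Fin (m + 1) → A} {M' : A ≃ B}
    (hM' : s.IsApplied R M') (a : A) :
    progress PA s a ≤ progress PA (s.afterRotation PA (Set.range R) M') a := by
  by_cases ha : a ∈ s.newN PA (Set.range R) M'
  · rw [progress_of_mem (s := s.afterRotation PA (Set.range R) M') ha]
    exact progress_le PA s a
  have haN : a ∉ s.N := fun h' => ha (.inl h')
  rcases h.p_afterRotation hcur htodo hM' ha with ⟨⟨k, rfl⟩, b, hb, hlt⟩ | ⟨-, hp, -⟩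
  · rw [progress_of_notMem (s := s.afterRotation PA (Set.range R) M') ha hb,
      progress_of_notMem haN (h.of_r _ haN _ (hM'.1 k)).1]
    exact ((PA _).rank_lt_rank hlt.1).le
  · obtain ⟨b, hb⟩ := h.exists_p a haN
    rw [progress_of_notMem (s := s.afterRotation PA (Set.range R) M') ha (hp.trans hb),
      progress_of_notMem haN hb]

variable [Fintype A]

/-- A quantity that every step of the algorithm increases. -/
noncomputable def potential (PA : A → Pref B) : AlgState A B → ℕ
  | .proposing held declined => ∑ a, (declined a).ncard + {b | held b ≠ none}.ncard
  | .searching s =>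
    -- The initial constant exceeds every value in the proposing phase. The factor `2 * Fintype.card
    -- A + 1` lets one rotation pay for resetting the last two counts, each at most `Fintype.card
    -- A`.
    Fintype.card A * Fintype.card B + Fintype.card B + 1 + ∑ a, progress PA s a +
      (2 * Fintype.card A + 1) * rankSum PA s.M + (s.todo)ᶜ.ncard +
      {a | a ∉ s.todo ∧ s.cur ≠ some a}.ncard
  | .halted M =>
    Fintype.card A * Fintype.card B + Fintype.card B + 1 + Fintype.card A * Fintype.card B +
      (2 * Fintype.card A + 1) * rankSum PA M + 2 * Fintype.card A + 1

theorem ncard_le_card {X : Type u} [Fintype X] (S : Set X) : S.ncard ≤ Fintype.card X := by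
  rw [← Nat.card_eq_fintype_card, ← Set.ncard_univ]
  exact Set.ncard_le_ncard (Set.subset_univ S) (Set.toFinite _)

theorem sum_le_mul {f : A → ℕ} {c : ℕ} (h : ∀ a, f a ≤ c) : ∑ a, f a ≤ Fintype.card A * c := by
  simpa using Finset.sum_le_card_nsmul Finset.univ f c fun a _ => h a

open Classical in
theorem sum_ncard_update_insert (declined : A → Set B) {a : A} {b : B} (hb : b ∉ declined a) :
    ∑ x, (Function.update declined a (insert b (declined a)) x).ncard =
      ∑ x, (declined x).ncard + 1 := by
  rw [← Finset.add_sum_erase _ _ (Finset.mem_univ a),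
    ← Finset.add_sum_erase _ (fun x => (declined x).ncard) (Finset.mem_univ a),
    Function.update_self, Set.ncard_insert_of_notMem hb (Set.toFinite _),
    Finset.sum_congr rfl fun x hx => by rw [Function.update_of_ne (Finset.ne_of_mem_erase hx)]]
  omega

theorem sum_progress_lt {s s' : SearchState A B} (h : ∀ x, progress PA s x ≤ progress PA s' x)
    (a : A) (ha : progress PA s a < progress PA s' a) :
    ∑ x, progress PA s x < ∑ x, progress PA s' x :=
  Finset.sum_lt_sum (fun x _ => h x) ⟨a, Finset.mem_univ a, ha⟩

theorem SearchInv.rankSum_lt {s : SearchState A B} (h : SearchInv PA PB s)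
    {m : ℕ} {R : Fin (m + 1) → A} {M' : A ≃ B} (hR : s.IsRotation R) (hM' : s.IsApplied R M') :
    rankSum PA s.M < rankSum PA M' := by
  refine Finset.sum_lt_sum (fun a _ => ?_) ⟨R 0, Finset.mem_univ _, ?_⟩
  · by_cases ha : a ∈ Set.range R
    · exact ((PA a).rank_lt_rank (h.lt_of_isApplied hR hM' ha)).le
    · rw [hM'.2 a ha]
  · exact (PA _).rank_lt_rank (h.lt_of_isApplied hR hM' ⟨0, rfl⟩)

theorem potential_proposing_le (PA : A → Pref B) (held : B → Option A) (declined : A → Set B) :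
    potential PA (.proposing held declined) ≤
      Fintype.card A * Fintype.card B + Fintype.card B :=
  Nat.add_le_add (sum_le_mul fun a => ncard_le_card (declined a)) (ncard_le_card _)

/-- A proposal fills a place or adds a new rejection. In the search, an unsuccessful query raises
the progress, a found `r`-edge or a newly considered agent raises one of the last two counts, and a
rotation raises the rank sum. -/
theorem AlgInv.potential_lt {s s' : AlgState A B} {e : Event A B}
    (h : AlgInv PA PB s) (hs : AlgStep PA s e s') : potential PA s < potential PA s' := by
  classical
  cases hs with
  | @proposeFree held declined a b hfree hfav hheld =>
    refine Nat.add_lt_add_left (Set.ncard_lt_ncard ⟨fun y hy => ?_, fun hsub => ?_⟩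
      (Set.toFinite _)) _
    · simp only [Set.mem_ofPred_eq, Function.update_apply] at hy ⊢
      split_ifs
      · simp
      · exact hy
    · exact hsub (a := b) (by simp) hheld
  | @proposeAccepted held declined a a' b hfree hfav hheld =>
    have hb : b ∉ declined a' := (ProposingInv.isFavourite h a' b hheld).1
    have hheld' : {y | held y ≠ none} ⊆ {y | Function.update held b (some a) y ≠ none} := by
      intro y hy
      simp only [Set.mem_ofPred_eq, Function.update_apply] at hy ⊢
      split_ifs
      · simp
      · exact hy
    have := Set.ncard_le_ncard hheld' (Set.toFinite _)
    have hsum := sum_ncard_update_insert declined hb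
    simp only [potential]
    omega
  | @proposeRejected held declined a a' b hfree hfav hheld =>
    have hsum := sum_ncard_update_insert declined (a := a) (b := b) hfav.1
    simp only [potential]
    omega
  | @startSearch held declined M hM =>
    have := potential_proposing_le PA held declined
    refine lt_of_le_of_lt this ?_
    simp only [potential]
    omega
  | @consider s a hcur ha =>
    have h₁ : (s.todo)ᶜ.ncard < (s.todo \ {a})ᶜ.ncard := by
      refine Set.ncard_lt_ncard ⟨fun x hx hx' => hx hx'.1, fun hsub => ?_⟩ (Set.toFinite _)
      exact hsub (a := a) (by simp) ha
    have h₂ : {x | x ∉ s.todo ∧ s.cur ≠ some x}.ncard ≤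
        {x | x ∉ s.todo \ {a} ∧ some a ≠ some x}.ncard := by
      refine Set.ncard_le_ncard (fun x hx => ⟨fun hx' => hx.1 hx'.1, ?_⟩) (Set.toFinite _)
      intro hax
      cases hax
      exact hx.1 ha
    have h₃ : ∀ x, progress PA { s with todo := s.todo \ {a}, cur := some a } x =
      progress PA s x := fun x => rfl
    simp only [potential, h₃]
    omega
  | @searchOn s a b b' hcur hp hnext =>
    have haN := SearchInv.notMem_N_of_cur h a hcur
    have hlt_a : progress PA s a <
        progress PA { s with p := Function.update s.p a (some b') } a := by
      rw [progress_of_notMem haN hp, progress_of_notMem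
        (s := { s with p := Function.update s.p a (some b') }) haN
        (b := b') (by simp)]
      exact (PA a).rank_lt_rank (Pref.isDirectSucc_of_next_eq_some hnext).1
    have hlt := sum_progress_lt (PA := PA) (s := s)
      (s' := { s with p := Function.update s.p a (some b') }) (fun x => ?_) a hlt_a
    · simp only [potential]
      omega
    · by_cases hxa : x = a
      · subst hxa
        exact hlt_a.le
      · simp [progress, hxa]
  | @searchExhausted s a b hcur hp hlast =>
    have haN := SearchInv.notMem_N_of_cur h a hcur
    have hlt := sum_progress_lt (PA := PA) (s := s)
      (s' := { s with N := insert a s.N, cur := none }) (fun x => ?_) a ?_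
    · have h₂ : {x | x ∉ s.todo ∧ s.cur ≠ some x}.ncard ≤
          {x | x ∉ s.todo ∧ none ≠ some x}.ncard :=
        Set.ncard_le_ncard (fun x hx => ⟨hx.1, by simp⟩) (Set.toFinite _)
      simp only [potential]
      omega
    · by_cases hxN : x ∈ insert a s.N
      · rw [progress_of_mem (s := { s with N := insert a s.N, cur := none }) hxN]
        exact progress_le PA s x
      · have hxN' : x ∉ s.N := fun h' => hxN (.inr h')
        simp [progress, hxN, hxN']
    · rw [progress_of_notMem haN hp, progress_of_mem (Set.mem_insert a s.N)]
      exact (PA a).rank_lt_card b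
  | @searchFound s a b hcur hp =>
    have h₁ := SearchInv.notMem_todo_of_cur h a hcur
    have h₂ : {x | x ∉ s.todo ∧ s.cur ≠ some x}.ncard <
        {x | x ∉ s.todo ∧ none ≠ some x}.ncard := by
      refine Set.ncard_lt_ncard ⟨fun x hx => ⟨hx.1, by simp⟩, fun hsub => ?_⟩ (Set.toFinite _)
      exact (hsub (a := a) ⟨h₁, by simp⟩).2 hcur
    have h₃ : ∀ x, progress PA { s with r := Function.update s.r a (some b), cur := none } x =
      progress PA s x := fun x => rfl
    simp only [potential, h₃]
    omega
  | @rotate s m R M' hcur htodo hR hM' =>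
    have h₁ := Finset.sum_le_sum fun a (_ : a ∈ Finset.univ) =>
      SearchInv.progress_le_afterRotation h hcur htodo hM' a
    have h₂ : rankSum PA s.M + 1 ≤ rankSum PA M' := SearchInv.rankSum_lt h hR hM'
    have h₃ := Nat.mul_le_mul_left (2 * Fintype.card A + 1) h₂
    have h₄ := ncard_le_card (s.todo)ᶜ
    have h₅ := ncard_le_card {x | x ∉ s.todo ∧ s.cur ≠ some x}
    have h₆ : (s.afterRotation PA (Set.range R) M').M = M' := rfl
    rw [Nat.mul_add, Nat.mul_one] at h₃
    simp only [potential, h₆]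
    omega
  | @finish s hcur htodo hno =>
    have h₁ := sum_le_mul (progress_le PA s)
    have h₄ := ncard_le_card (s.todo)ᶜ
    have h₅ := ncard_le_card {x | x ∉ s.todo ∧ s.cur ≠ some x}
    simp only [potential]
    omega

/-- Termination uses the trivial `K = |A| * |B|`, the query count uses `K = OPT`. -/
theorem AlgInv.potential_le {K : ℕ} (hK : ∀ M : A ≃ B, IsStable PA PB M → rankSum PA M ≤ K)
    {s : AlgState A B} (h : AlgInv PA PB s) :
    potential PA s ≤ Fintype.card A * Fintype.card B + Fintype.card B + 1 +
      Fintype.card A * Fintype.card B + (2 * Fintype.card A + 1) * K + 2 * Fintype.card A + 1 := by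
  cases s with
  | proposing held declined =>
    refine (potential_proposing_le PA held declined).trans ?_
    omega
  | searching s =>
    have h₁ := sum_le_mul (progress_le PA s)
    have h₂ := Nat.mul_le_mul_left (2 * Fintype.card A + 1) (hK s.M (SearchInv.isStable h))
    have h₄ := ncard_le_card (s.todo)ᶜ
    have h₅ := ncard_le_card {x | x ∉ s.todo ∧ s.cur ≠ some x}
    simp only [potential]
    omega
  | halted M =>
    have h₂ := Nat.mul_le_mul_left (2 * Fintype.card A + 1) (hK M h.1)
    simp only [potential]
    omega

end Potential

/-! ### Executions -/

open QueryAlgorithm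

theorem algInv_of_reaches [Finite A] [Finite B] {k : ℕ}
    {s : (bOptimalAlgorithm PA).State}
    (h : (bOptimalAlgorithm PA).Reaches PB k s) : AlgInv PA PB s := by
  induction h with
  | start => exact ProposingInv.start PA PB
  | step _ hs ih => exact AlgInv.step ih hs.1 hs.2

theorem le_potential_of_reaches [Fintype A] [Fintype B] {k : ℕ}
    {s : (bOptimalAlgorithm PA).State}
    (h : (bOptimalAlgorithm PA).Reaches PB k s) : k ≤ potential PA s := by
  induction h with
  | start => exact Nat.zero_le _
  | @step k s s' e hr hs ih =>
    have hlt := AlgInv.potential_lt (algInv_of_reaches hr) hs.1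
    have hcost : e.cost ≤ 1 := by cases e <;> simp [Event.cost]
    exact (Nat.add_le_add ih hcost).trans hlt

theorem eq_zero_of_reaches [Finite A] [Finite B] [Subsingleton A] {k : ℕ}
    {s : (bOptimalAlgorithm PA).State}
    (h : (bOptimalAlgorithm PA).Reaches PB k s) : k = 0 := by
  induction h with
  | start => rfl
  | step hr hs ih => rw [ih, AlgInv.cost_eq_zero (algInv_of_reaches hr) hs.1]

/-- No infinite sequence of steps starts from a reachable state. -/
theorem not_exists_infinite [Fintype A] [Fintype B] {k : ℕ}
    {s : (bOptimalAlgorithm PA).State}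
    (h : (bOptimalAlgorithm PA).Reaches PB k s) :
    ¬ ∃ f : ℕ → AlgState A B, f 0 = s ∧
      ∀ i, ∃ e, (bOptimalAlgorithm PA).TrueStep PB (f i) e (f (i + 1)) := by
  rintro ⟨f, rfl, hf⟩
  have hbound : ∀ i, AlgInv PA PB (f i) ∧ i ≤ potential PA (f i) := by
    intro i
    induction i with
    | zero => exact ⟨algInv_of_reaches h, Nat.zero_le _⟩
    | succ i ih =>
      obtain ⟨e, hs⟩ := hf i
      exact ⟨AlgInv.step ih.1 hs.1 hs.2, lt_of_le_of_lt ih.2 (AlgInv.potential_lt ih.1 hs.1)⟩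
  have hK : ∀ M : A ≃ B, IsStable PA PB M →
      rankSum PA M ≤ Fintype.card A * Fintype.card B :=
    fun M _ => sum_le_mul fun a => ((PA a).rank_lt_card (M a)).le
  have hle := fun i => (hbound i).2.trans ((hbound i).1.potential_le hK)
  exact absurd (hle _) (Nat.not_succ_le_self _)

theorem findsBOptimal [Fintype A] [Fintype B] (hAB : Fintype.card A = Fintype.card B)
    (PA : A → Pref B) (PB : B → Pref A) : (bOptimalAlgorithm PA).FindsBOptimal PA PB :=
  ⟨not_exists_infinite .start, fun _ _ hr hstuck =>
    (algInv_of_reaches hr).exists_output hAB hstuck⟩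

/-- The algorithm itself proves existence: it is stuck only at a `B`-optimal matching, so without
one it could be continued forever. -/
theorem exists_isBOptimal [Fintype A] [Fintype B] (hAB : Fintype.card A = Fintype.card B)
    (PA : A → Pref B) (PB : B → Pref A) : ∃ M, IsBOptimal PA PB M := by
  by_contra hno
  have hstep : ∀ s : {s : AlgState A B // AlgInv PA PB s},
      ∃ s' : {s : AlgState A B // AlgInv PA PB s}, ∃ e,
        (bOptimalAlgorithm PA).TrueStep PB s.1 e s'.1 := by
    rintro ⟨s, hs⟩
    by_contra hstuck
    obtain ⟨M, -, hM⟩ := hs.exists_output hAB fun ⟨e, s', h, he⟩ =>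
      hstuck ⟨⟨s', hs.step h he⟩, e, h, he⟩
    exact hno ⟨M, hM⟩
  choose g hg using hstep
  refine (findsBOptimal hAB PA PB).1 ⟨fun i => (g^[i] ⟨.proposing (fun _ => none) (fun _ => ∅),
    ProposingInv.start PA PB⟩).1, rfl,
    fun i => ?_⟩
  simp only [Function.iterate_succ_apply']
  exact hg _

theorem queriesAtMost [Fintype A] [Fintype B] (hAB : Fintype.card A = Fintype.card B)
    (PA : A → Pref B) (PB : B → Pref A) :
    (bOptimalAlgorithm PA).QueriesAtMost PB (15 * Fintype.card A * opt PA PB) := by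
  intro k s hr
  obtain ⟨M, hM⟩ := exists_isBOptimal hAB PA PB
  obtain ⟨hcard, hrank⟩ := opt_bounds hM
  -- For `n ≤ 1` the lower bound `n ≤ 3 * OPT + 1` does not exclude `OPT = 0`, so it has to be used
  -- that no query is made.
  rcases Nat.lt_or_ge 1 (Fintype.card A) with hn | hn
  · have hk := (le_potential_of_reaches hr).trans ((algInv_of_reaches hr).potential_le hrank)
    rw [← hAB] at hk
    generalize Fintype.card A = n at *
    generalize opt PA PB = o at *
    -- Here `n ≥ 2` forces `o ≥ 1`. The bound `2 * n ^ 2 + 3 * n + 2 + (2 * n + 1) * o` is then at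
    -- most `(8 + 3 + 1 + 3) * n * o`, whence the constant `15`.
    have ho : n ≤ 4 * o := by omega
    have h₁ : n * n ≤ n * (4 * o) := Nat.mul_le_mul_left n ho
    have h₂ : n * 1 ≤ n * o := Nat.mul_le_mul_left n (by omega)
    have h₃ : 1 * o ≤ n * o := Nat.mul_le_mul_right o (by omega)
    nlinarith
  · have : Subsingleton A := Fintype.card_le_one_iff_subsingleton.1 hn
    rw [eq_zero_of_reaches hr]
    exact Nat.zero_le _

end StableMatching

theorem mainTheorem1 :
    ∃ C : ℕ, ∀ (n : ℕ) (A : Type u) (B : Type v) [Fintype A] [Fintype B],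
      Fintype.card A = n → Fintype.card B = n →
      ∀ (PA : A → Pref B) (PB : B → Pref A),
        (StableMatching.bOptimalAlgorithm PA).FindsBOptimal PA PB ∧
        (StableMatching.bOptimalAlgorithm PA).QueriesAtMost PB
          (C * n * StableMatching.opt PA PB) := by
  refine ⟨15, ?_⟩
  rintro n A B _ _ rfl hB PA PB
  exact ⟨StableMatching.findsBOptimal hB.symm PA PB, StableMatching.queriesAtMost hB.symm PA PB⟩
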